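/- Let $n\ge 0$, $[n]=\{1,\dots,n\}$, and let $f:2^{[n]}\to\mathbb{Z}$ satisfy $f(\emptyset)=0$ and $f(I)+f(J)\ge f(I\cup J)+f(I\cap J)$ for all $I,J\subset[n]$. Let $$P=\Big\{a\in\mathbb{Z}^n : \sum_{i\in I}a_i\le f(I)\ \text{for all } I\subset[n],\ \sum_{i\in[n]}a_i=f([n])\Big\}$$ be the (integer) polymatroid over $[n]$ with rank function $f$, and assume that $P\subset\mathbb{Z}^n_{\ge 0}$. For $a\in P$ an index $i\in[n]$ is called externally active if $a+\mathbf{e}_i-\mathbf{e}_j\notin P$ for every $j<i$, where $\mathbf{e}_1,\dots,\mathbf{e}_n$ are the standard unit vectors; let $\epsilon(a)$ be the number of externally active indices, and let $$X_P(y)=\sum_{a\in P}y^{\,n-\epsilon(a)}$$ be the exterior polynomial of $P$. Then for every integer $k$ with $0\le k\le n$ the following are equivalent: 1. $f([n]\setminus J)=f([n])$ for all $J\subset[n]$ with $|J|=k$; 2. for every integer $0\le i\le k$, the coefficient of $y^i$ in $X_P(y)$ equals $\binom{f([n])+i-1}{i}$ (where $\binom{-1}{0}=1$). -/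

import Mathlib

open Polynomial

/-- The conditions on the rank function of an integer polymatroid over the ground set `Fin n`:
it vanishes on the empty set and is submodular. -/
structure IsPolymatroidRank {n : ℕ} (f : Finset (Fin n) → ℤ) : Prop where
  map_empty : f ∅ = 0
  submodular : ∀ I J : Finset (Fin n), f (I ∪ J) + f (I ∩ J) ≤ f I + f J

/-- The set of integer vectors `a` with `∑ i ∈ I, a i ≤ f I` for all `I`, and equality
when `I` is the whole ground set. -/
def polymatroidOf {n : ℕ} (f : Finset (Fin n) → ℤ) : Set (Fin n → ℤ) :=
  {a | (∀ I : Finset (Fin n), ∑ i ∈ I, a i ≤ f I) ∧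
    ∑ i ∈ (Finset.univ : Finset (Fin n)), a i = f Finset.univ}

/-- `P` is a polymatroid (more precisely, the set of integer bases of one) over `Fin n` with
rank function `f`. -/
structure IsPolymatroid {n : ℕ} (P : Set (Fin n → ℤ)) (f : Finset (Fin n) → ℤ) : Prop where
  rank : IsPolymatroidRank f
  eq_polymatroidOf : P = polymatroidOf f

open Classical in
/-- The set of externally active indices of `a` with respect to `P`: those `i` such that
`a + e_i - e_j ∉ P` for every `j < i`. -/
noncomputable def externallyActive {n : ℕ} (P : Set (Fin n → ℤ)) (a : Fin n → ℤ) :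
    Finset (Fin n) :=
  Finset.univ.filter fun i => ∀ j : Fin n, j < i → a + Pi.single i 1 - Pi.single j 1 ∉ P

/-- The exterior polynomial of `P`: the sum over `a ∈ P` of `y` to the number of indices that
are not externally active. The sum is finite by `IsPolymatroid.finite` below. -/
noncomputable def exteriorPolynomial {n : ℕ} (P : Set (Fin n → ℤ)) : ℤ[X] :=
  ∑ᶠ a ∈ P, X ^ (n - (externallyActive P a).card)

/-- A polymatroid is a finite set. -/
theorem IsPolymatroid.finite {n : ℕ} {P : Set (Fin n → ℤ)} {f : Finset (Fin n) → ℤ}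
    (h : IsPolymatroid P f) : P.Finite := by
  refine (Set.finite_Icc (fun i => f Finset.univ - f (Finset.univ.erase i))
    (fun i => f {i})).subset ?_
  rw [h.eq_polymatroidOf]
  rintro a ⟨ha, hs⟩
  refine ⟨fun i => ?_, fun i => by simpa using ha {i}⟩
  have h1 := ha (Finset.univ.erase i)
  have h2 := Finset.add_sum_erase Finset.univ a (Finset.mem_univ i)
  show f Finset.univ - f (Finset.univ.erase i) ≤ a i
  linarith

/-! Call a vector `c ≥ 0` spanning if it lies above some member of `P`. It then splits uniquely as
`a + m` with `a ∈ P` and `m` supported on the externally active indices of `a`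
(`IsPolymatroid.card_isSpanning`). With `d = f univ`, the spanning vectors of sum `d + t` thus
number `∑ i, coeff i * (n - i).multichoose t`. All nonnegative vectors of that sum have the same
expansion with `d.multichoose i` as coefficients, so the differences of coefficients count the
nonspanning vectors (`IsPolymatroid.nonspanningCount_eq`).

Since `t ↦ m.multichoose t` has degree `m - 1` for `m > 0`, the coefficients agree up to `k < n`
exactly when the nonspanning vectors are negligible against `(n - k).multichoose t`. Spanning means
dominating the corank function. If coranks vanish on `k`-sets, a nonspanning vector has at least `k
+ 1` bounded entries, so there are too few of them. If a `k`-set has positive corank, all vectors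
vanishing on it are nonspanning, which is too many. -/

section Multichoose

/-! ### Identities and estimates for multiset coefficients -/

theorem Nat.multichoose_succ_symm (m t : ℕ) :
    (m + 1).multichoose t = (t + 1).multichoose m := by
  rw [Nat.multichoose_eq, Nat.multichoose_eq, show m + 1 + t - 1 = m + t by omega,
    show t + 1 + m - 1 = m + t by omega, Nat.choose_symm_add]

/-- Vandermonde convolution: compare coefficients in `(1 - x)^(-d) * (1 - x)^(-s)`. -/
theorem Nat.multichoose_add (d s m : ℕ) :
    (d + s).multichoose m =
      ∑ i ∈ Finset.range (m + 1), d.multichoose i * s.multichoose (m - i) := by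
  induction d generalizing m with
  | zero =>
    rw [Finset.sum_eq_single 0]
    · simp
    · intro i _ hi
      obtain ⟨j, rfl⟩ := Nat.exists_eq_succ_of_ne_zero hi
      simp
    · simp
  | succ d ih =>
    induction m with
    | zero => simp
    | succ m ihm =>
      rw [show d + 1 + s = (d + s) + 1 by omega, Nat.multichoose_succ_succ, ih,
        show d + s + 1 = d + 1 + s by omega, ihm, Finset.sum_range_succ' _ (m + 1),
        Finset.sum_range_succ' (fun i => (d + 1).multichoose i * _) (m + 1)]
      simp only [Nat.multichoose_succ_succ, add_mul, Finset.sum_add_distrib,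
        Nat.multichoose_zero_right, Nat.add_sub_add_right]
      ring

/-- The symmetry turns the left side into `(d + (t + 1)).multichoose n`, to which the convolution
applies. This is the source of the coefficients `d.multichoose i`. -/
theorem Nat.multichoose_succ_add (n d t : ℕ) :
    (n + 1).multichoose (d + t) =
      ∑ i ∈ Finset.range (n + 1), d.multichoose i * (n + 1 - i).multichoose t := by
  rw [Nat.multichoose_succ_symm, add_assoc, Nat.multichoose_add]
  refine Finset.sum_congr rfl fun i hi => ?_
  have : i ≤ n := by simpa [Nat.lt_succ_iff] using hi
  rw [← Nat.multichoose_succ_symm, Nat.sub_add_comm this]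

theorem Nat.mul_multichoose_succ (m t : ℕ) :
    m * (m + 1).multichoose t = (t + m) * m.multichoose t := by
  cases m with
  | zero => cases t <;> simp
  | succ m =>
    have := Nat.choose_mul_succ_eq (m + t) t
    rw [Nat.multichoose_eq, Nat.multichoose_eq, show m + 1 + 1 + t - 1 = m + t + 1 by omega,
      show m + 1 + t - 1 = m + t by omega]
    rw [show m + t + 1 - t = m + 1 by omega] at this
    linarith

theorem Nat.multichoose_le_succ_left (m t : ℕ) : m.multichoose t ≤ (m + 1).multichoose t := by
  cases t with
  | zero => simp
  | succ t => rw [Nat.multichoose_succ_succ]; omega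

theorem Nat.multichoose_succ_right_le (m t : ℕ) :
    m.multichoose (t + 1) ≤ m * m.multichoose t := by
  induction m with
  | zero => simp
  | succ m ih =>
    rw [Nat.multichoose_succ_succ]
    have := Nat.mul_le_mul_left m (Nat.multichoose_le_succ_left m t)
    linarith

theorem Nat.multichoose_add_right_le (m t d : ℕ) :
    m.multichoose (t + d) ≤ m ^ d * m.multichoose t := by
  induction d with
  | zero => simp
  | succ d ih =>
    calc m.multichoose (t + (d + 1)) ≤ m * m.multichoose (t + d) :=
          Nat.multichoose_succ_right_le _ _
      _ ≤ m * (m ^ d * m.multichoose t) := Nat.mul_le_mul_left _ ih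
      _ = _ := by ring

/-- `s = 0` must be excluded: for `m = 0` the value drops from 1 to 0 there. -/
theorem Nat.multichoose_le_of_le (m : ℕ) {s t : ℕ} (hs : 1 ≤ s) (h : s ≤ t) :
    m.multichoose s ≤ m.multichoose t := by
  induction t, h using Nat.le_induction with
  | base => rfl
  | succ t ht ih =>
    refine ih.trans ?_
    cases m with
    | zero =>
      obtain ⟨t, rfl⟩ := Nat.exists_eq_succ_of_ne_zero (show t ≠ 0 by omega)
      simp
    | succ m => rw [Nat.multichoose_succ_succ]; omega

theorem Nat.multichoose_pos {m : ℕ} (hm : 0 < m) (t : ℕ) : 0 < m.multichoose t := by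
  rw [Nat.multichoose_eq]
  exact Nat.choose_pos (by omega)

theorem Finset.card_piAntidiag_multichoose {ι : Type*} [DecidableEq ι] (s : Finset ι) (t : ℕ) :
    (Finset.piAntidiag s t).card = s.card.multichoose t := by
  rw [← Finset.card_finsuppAntidiag_nat_eq_multichoose]
  symm
  refine Finset.card_bij (fun x _ => ⇑x) ?_ (fun _ _ _ _ h => DFunLike.coe_injective h) ?_
  · intro x hx
    rw [Finset.mem_finsuppAntidiag] at hx
    exact Finset.mem_piAntidiag.2 ⟨hx.1, fun i hi => hx.2 (Finsupp.mem_support_iff.2 hi)⟩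
  · intro x hx
    rw [Finset.mem_piAntidiag] at hx
    exact ⟨Finsupp.onFinset s x hx.2, Finset.mem_finsuppAntidiag.2
      ⟨hx.1, Finsupp.support_onFinset_subset⟩, rfl⟩

/-! ### Growth rates of multiset coefficients -/

open Asymptotics Filter

theorem isLittleO_multichoose_succ (m : ℕ) :
    (fun t : ℕ => (m.multichoose t : ℝ)) =o[atTop]
      fun t : ℕ => ((m + 1).multichoose t : ℝ) := by
  rw [isLittleO_iff]
  intro c hc
  obtain ⟨T, hT⟩ := exists_nat_gt ((m : ℝ) / c)
  filter_upwards [eventually_ge_atTop (T + 1)] with t ht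
  have h := Nat.mul_multichoose_succ m t
  simp only [Real.norm_natCast]
  rcases Nat.eq_zero_or_pos m with rfl | hm
  · obtain ⟨s, rfl⟩ := Nat.exists_eq_succ_of_ne_zero (show t ≠ 0 by omega)
    simp [hc.le]
  · have hm' : (0 : ℝ) < m := by exact_mod_cast hm
    have h' : (m : ℝ) * ((m + 1).multichoose t : ℝ) = (t + m) * (m.multichoose t : ℝ) := by
      exact_mod_cast h
    have ht' : (T : ℝ) ≤ t := by exact_mod_cast (by omega : T ≤ t)
    rw [div_lt_iff₀ hc] at hT
    refine le_of_mul_le_mul_left ?_ hm'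
    calc (m : ℝ) * (m.multichoose t : ℝ) ≤ (c * (t + m)) * (m.multichoose t : ℝ) := by
          gcongr
          nlinarith
      _ = m * (c * ((m + 1).multichoose t : ℝ)) := by rw [mul_assoc, ← h']; ring

theorem isLittleO_multichoose {m m' : ℕ} (h : m < m') :
    (fun t : ℕ => (m.multichoose t : ℝ)) =o[atTop] fun t : ℕ => (m'.multichoose t : ℝ) := by
  induction m', (show m + 1 ≤ m' from h) using Nat.le_induction with
  | base => exact isLittleO_multichoose_succ m
  | succ q hq ih => exact (ih hq).trans (isLittleO_multichoose_succ q)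

theorem not_isLittleO_multichoose_self {m : ℕ} (hm : 0 < m) :
    ¬ (fun t : ℕ => (m.multichoose t : ℝ)) =o[atTop] fun t : ℕ => (m.multichoose t : ℝ) := by
  refine isLittleO_irrefl (Frequently.of_forall fun t => ?_)
  exact_mod_cast (Nat.multichoose_pos hm t).ne'

/-- If the coefficients of index less than `l` of a combination of the functions
`t ↦ (n - i).multichoose t` vanish, then the combination is negligible against
`t ↦ m.multichoose t` for all `m > n - l`. -/
theorem isLittleO_sum_multichoose {n l m : ℕ} (δ : ℕ → ℝ) (hδ : ∀ i < l, δ i = 0)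
    (hm : n < m + l) (s : Finset ℕ) (hs : ∀ i ∈ s, i ≤ n) :
    (fun t : ℕ => ∑ i ∈ s, δ i * ((n - i).multichoose t : ℝ)) =o[atTop]
      fun t : ℕ => (m.multichoose t : ℝ) := by
  refine IsLittleO.fun_sum fun i hi => ?_
  by_cases hil : i < l
  · simp [hδ i hil]
  · have := hs i hi
    exact (isLittleO_multichoose (by omega)).const_mul_left _

/-- The coefficients of a combination of the functions `t ↦ (n - i).multichoose t` vanish up to
index `k` if the combination is negligible against `t ↦ (n - k).multichoose t`. -/
theorem coeff_eq_zero_of_isLittleO_multichoose {n k : ℕ} (hk : k < n) (δ : ℕ → ℝ)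
    (h : (fun t : ℕ => ∑ i ∈ Finset.range (n + 1), δ i * ((n - i).multichoose t : ℝ)) =o[atTop]
      fun t : ℕ => ((n - k).multichoose t : ℝ)) :
    ∀ i ≤ k, δ i = 0 := by
  intro i
  induction i using Nat.strong_induction_on with
  | _ i ih =>
    intro hi
    have h1 : (fun t : ℕ => ∑ j ∈ Finset.range (n + 1), δ j * ((n - j).multichoose t : ℝ))
        =o[atTop] fun t : ℕ => ((n - i).multichoose t : ℝ) := by
      rcases hi.lt_or_eq with hi | rfl
      · exact h.trans (isLittleO_multichoose (by omega))
      · exact h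
    -- The terms of index above `i` are negligible and those below `i` vanish by induction, so the
    -- `i`-th term alone must be negligible against its own growth rate.
    have h2 := isLittleO_sum_multichoose (n := n) (l := i + 1) (m := n - i)
      (fun j => if j ≤ i then 0 else δ j) (fun j hj => by simp [Nat.lt_succ_iff.1 hj]) (by omega)
      (Finset.range (n + 1)) (fun j hj => by simpa [Nat.lt_succ_iff] using hj)
    have h3 : (fun t : ℕ => δ i * ((n - i).multichoose t : ℝ)) =o[atTop]
        fun t : ℕ => ((n - i).multichoose t : ℝ) := by
      refine (h1.sub h2).congr_left fun t => ?_
      rw [← Finset.sum_sub_distrib, Finset.sum_eq_single_of_mem i (by simp; omega)]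
      · simp
      · intro j _ hj
        rcases lt_or_gt_of_ne hj with hj | hj
        · simp [hj.le, ih j hj (by omega)]
        · simp [not_le.2 hj]
    by_contra hne
    exact not_isLittleO_multichoose_self (by omega)
      ((isLittleO_const_mul_left_iff hne).1 h3)

end Multichoose

/-! ### Corank, spanning vectors and exchange -/

section Corank

variable {n : ℕ} {f : Finset (Fin n) → ℤ} {P : Set (Fin n → ℤ)}

theorem sum_pi_single_one (T : Finset (Fin n)) (i : Fin n) :
    ∑ j ∈ T, (Pi.single i (1 : ℤ) : Fin n → ℤ) j = if i ∈ T then 1 else 0 := by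
  simp [Pi.single_apply]

/-- The least possible value of the sum over `S` of the entries of a member of the polymatroid
with rank function `f`. -/
def corank (f : Finset (Fin n) → ℤ) (S : Finset (Fin n)) : ℤ :=
  f Finset.univ - f (Finset.univ \ S)

/-- `c` dominates the corank function of `f`; see `exists_le_of_isSpanning` for the meaning. -/
def IsSpanning (f : Finset (Fin n) → ℤ) (c : Fin n → ℤ) : Prop :=
  ∀ S : Finset (Fin n), corank f S ≤ ∑ i ∈ S, c i

@[simp] theorem corank_empty (f : Finset (Fin n) → ℤ) : corank f ∅ = 0 := by simp [corank]

theorem IsPolymatroidRank.corank_univ (hf : IsPolymatroidRank f) :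
    corank f Finset.univ = f Finset.univ := by simp [corank, hf.map_empty]

theorem IsPolymatroidRank.corank_supermodular (hf : IsPolymatroidRank f)
    (S T : Finset (Fin n)) : corank f S + corank f T ≤ corank f (S ∪ T) + corank f (S ∩ T) := by
  have h := hf.submodular (Finset.univ \ S) (Finset.univ \ T)
  have h1 : Finset.univ \ S ∪ Finset.univ \ T = Finset.univ \ (S ∩ T) := by
    ext; simp; tauto
  rw [h1, ← Finset.sdiff_union_distrib] at h
  unfold corank
  linarith

/-- Uncrossing: the sums of `c` are modular and the corank is supermodular, so no slack is left on
the union. -/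
theorem IsPolymatroidRank.tight_union (hf : IsPolymatroidRank f) {c : Fin n → ℤ}
    (hc : IsSpanning f c) {S T : Finset (Fin n)} (hS : ∑ i ∈ S, c i = corank f S)
    (hT : ∑ i ∈ T, c i = corank f T) : ∑ i ∈ S ∪ T, c i = corank f (S ∪ T) := by
  have h1 := hf.corank_supermodular S T
  have h2 := Finset.sum_union_inter (s₁ := S) (s₂ := T) (f := c)
  have h3 := hc (S ∪ T)
  have h4 := hc (S ∩ T)
  linarith

theorem IsPolymatroidRank.exists_tight_superset (hf : IsPolymatroidRank f) {c : Fin n → ℤ}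
    (hc : IsSpanning f c) (S : Finset (Fin n))
    (h : ∀ i ∈ S, ∃ T : Finset (Fin n), i ∈ T ∧ ∑ i ∈ T, c i = corank f T) :
    ∃ T, S ⊆ T ∧ ∑ i ∈ T, c i = corank f T := by
  induction S using Finset.induction_on with
  | empty => exact ⟨∅, by simp, by simp⟩
  | insert i S _ ih =>
    obtain ⟨T, hT, hT'⟩ := ih fun j hj => h j (Finset.mem_insert_of_mem hj)
    obtain ⟨U, hU, hU'⟩ := h i (Finset.mem_insert_self i S)
    refine ⟨U ∪ T, Finset.insert_subset (Finset.mem_union_left _ hU)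
      (hT.trans Finset.subset_union_right), hf.tight_union hc hU' hT'⟩

/-- A spanning vector can be lowered on `S` until `S` is contained in a tight set. -/
theorem IsPolymatroidRank.exists_isSpanning_tight (hf : IsPolymatroidRank f) {c : Fin n → ℤ}
    (hc : IsSpanning f c) (S : Finset (Fin n)) :
    ∃ b : Fin n → ℤ, IsSpanning f b ∧ (∀ i, b i ≤ c i) ∧ (∀ i ∉ S, b i = c i) ∧
      ∃ T, S ⊆ T ∧ ∑ i ∈ T, b i = corank f T := by
  -- Induct on a bound for the excess over the corank: by integrality, an entry in no tight set can
  -- be lowered by 1.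
  obtain ⟨N, hN⟩ : ∃ N : ℕ, ∑ i ∈ S, c i - corank f S ≤ N :=
    ⟨_, Int.self_le_toNat _⟩
  induction N generalizing c with
  | zero =>
    refine ⟨c, hc, fun _ => le_rfl, fun _ _ => rfl, S, subset_rfl, ?_⟩
    have := hc S
    push_cast at hN
    linarith
  | succ N ih =>
    by_cases h : ∀ i ∈ S, ∃ T : Finset (Fin n), i ∈ T ∧ ∑ i ∈ T, c i = corank f T
    · exact ⟨c, hc, fun _ => le_rfl, fun _ _ => rfl, hf.exists_tight_superset hc S h⟩
    · push Not at h
      obtain ⟨i, hi, hT⟩ := h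
      have hsum : ∀ T : Finset (Fin n), ∑ j ∈ T, (c - Pi.single i 1 : Fin n → ℤ) j =
          ∑ j ∈ T, c j - if i ∈ T then 1 else 0 := fun T => by
        simp only [Pi.sub_apply, Finset.sum_sub_distrib, sum_pi_single_one]
      obtain ⟨b, hb, hbc, hbS, T, hST, hbT⟩ := ih (c := c - Pi.single i 1) (by
        intro T
        rw [hsum]
        have h1 := hc T
        split_ifs with hiT
        · have := hT T hiT
          omega
        · omega) (by
        rw [hsum, if_pos hi]
        push_cast at hN
        linarith)
      refine ⟨b, hb, fun j => (hbc j).trans ?_, fun j hj => (hbS j hj).trans ?_, T, hST, hbT⟩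
      · by_cases hj : j = i
        · subst hj; simp
        · simp [hj]
      · have : j ≠ i := by rintro rfl; exact hj hi
        simp [this]

theorem mem_polymatroidOf_iff {a : Fin n → ℤ} :
    a ∈ polymatroidOf f ↔ IsSpanning f a ∧ ∑ i, a i = f Finset.univ := by
  constructor
  · rintro ⟨h1, h2⟩
    refine ⟨fun S => ?_, h2⟩
    have := h1 (Finset.univ \ S)
    have h3 := Finset.sum_sdiff (f := a) (Finset.subset_univ S)
    unfold corank
    linarith
  · rintro ⟨h1, h2⟩
    refine ⟨fun S => ?_, h2⟩
    have := h1 (Finset.univ \ S)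
    have h3 := Finset.sum_sdiff (f := a) (Finset.subset_univ S)
    rw [corank, Finset.sdiff_sdiff_eq_self (Finset.subset_univ S)] at this
    linarith

theorem IsSpanning.mono {a c : Fin n → ℤ} (ha : IsSpanning f a) (h : ∀ i, a i ≤ c i) :
    IsSpanning f c :=
  fun S => (ha S).trans (Finset.sum_le_sum fun i _ => h i)

theorem IsPolymatroidRank.exists_le_of_isSpanning (hf : IsPolymatroidRank f) {c : Fin n → ℤ}
    (hc : IsSpanning f c) : ∃ a ∈ polymatroidOf f, ∀ i, a i ≤ c i := by
  obtain ⟨a, ha, hac, -, T, hT, haT⟩ := hf.exists_isSpanning_tight hc Finset.univ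
  obtain rfl := Finset.univ_subset_iff.1 hT
  exact ⟨a, mem_polymatroidOf_iff.2 ⟨ha, haT.trans hf.corank_univ⟩, hac⟩

/-- The corank of every set is attained on the polymatroid. -/
theorem IsPolymatroidRank.exists_sum_eq_corank (hf : IsPolymatroidRank f) (S : Finset (Fin n)) :
    ∃ a ∈ polymatroidOf f, ∑ i ∈ S, a i = corank f S := by
  obtain ⟨B, hB⟩ : ∃ B : ℤ, ∀ T, |corank f T| ≤ B :=
    ⟨∑ T, |corank f T|, fun T =>
      Finset.single_le_sum (f := fun T => |corank f T|) (fun _ _ => abs_nonneg _)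
        (Finset.mem_univ T)⟩
  have hB0 : 0 ≤ B := (abs_nonneg _).trans (hB ∅)
  -- Entries outside `S` keep the value `2 * B + 1`. Coranks differ by at most `2 * B`, so a tight
  -- superset of `S` cannot contain any such entry.
  have hspan : IsSpanning f fun _ : Fin n => 2 * B + 1 := by
    intro U
    rcases U.eq_empty_or_nonempty with rfl | hU
    · simp
    · have h1 : (1 : ℤ) ≤ U.card := by exact_mod_cast hU.card_pos
      have h2 := le_of_abs_le (hB U)
      simp only [Finset.sum_const, nsmul_eq_mul]
      nlinarith
  obtain ⟨b, hb, -, hbS, T, hST, hbT⟩ := hf.exists_isSpanning_tight hspan S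
  have hTS : T = S := by
    refine (hST.antisymm ?_).symm
    rw [← Finset.sdiff_eq_empty_iff_subset, ← Finset.not_nonempty_iff_eq_empty]
    intro hne
    have h1 : (1 : ℤ) ≤ (T \ S).card := by exact_mod_cast hne.card_pos
    have h2 : ∑ i ∈ T \ S, b i = (T \ S).card * (2 * B + 1) := by
      rw [Finset.sum_congr rfl fun i hi => hbS i (Finset.mem_sdiff.1 hi).2]
      simp
    have h3 := Finset.sum_sdiff (f := b) hST
    have h4 := hb S
    have h5 := abs_le.1 (hB S)
    have h6 := abs_le.1 (hB T)
    nlinarith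
  subst hTS
  obtain ⟨a, ha, hab⟩ := hf.exists_le_of_isSpanning hb
  exact ⟨a, ha, ((Finset.sum_le_sum fun i _ => hab i).trans_eq hbT).antisymm
    ((mem_polymatroidOf_iff.1 ha).1 T)⟩

/-- Take a member attaining the corank of `T`; its entries are nonnegative, so its sum over `S` is
no larger. -/
theorem IsPolymatroid.corank_mono (h : IsPolymatroid P f) (hP : ∀ a ∈ P, ∀ i : Fin n, 0 ≤ a i)
    {S T : Finset (Fin n)} (hST : S ⊆ T) : corank f S ≤ corank f T := by
  obtain ⟨a, ha, haT⟩ := h.rank.exists_sum_eq_corank T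
  rw [← haT]
  refine ((mem_polymatroidOf_iff.1 ha).1 S).trans
    (Finset.sum_le_sum_of_subset_of_nonneg hST fun i _ _ => hP a ?_ i)
  rwa [h.eq_polymatroidOf]

/-- The exchange property of polymatroids. -/
theorem IsPolymatroidRank.exchange (hf : IsPolymatroidRank f) {a b : Fin n → ℤ}
    (ha : a ∈ polymatroidOf f) (hb : b ∈ polymatroidOf f) {i : Fin n} (hi : a i < b i) :
    ∃ j, b j < a j ∧ a + Pi.single i 1 - Pi.single j 1 ∈ polymatroidOf f := by
  by_contra! hcon
  have hsum : ∀ (j : Fin n) (T : Finset (Fin n)),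
      ∑ l ∈ T, (a + Pi.single i 1 - Pi.single j 1 : Fin n → ℤ) l = ∑ l ∈ T, a l + (if i ∈ T then 1 else 0) - if j ∈ T then 1 else 0 := fun j T => by
    simp only [Pi.sub_apply, Pi.add_apply, Finset.sum_sub_distrib, Finset.sum_add_distrib,
      sum_pi_single_one]
  -- Each failed exchange yields a tight set through `j` avoiding `i`. Off the union `T` of these
  -- sets `a ≤ b`, strictly at `i`, so `b` would sum on `T` to less than its corank.
  have hcover : ∀ j ∈ Finset.univ.filter (fun j => b j < a j), ∃ T : Finset (Fin n), j ∈ T ∧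
      i ∉ T ∧ ∑ l ∈ T, a l = corank f T := by
    intro j hj
    have h := hcon j (by simpa using hj)
    rw [mem_polymatroidOf_iff, not_and'] at h
    specialize h (by rw [hsum]; simpa using ha.2)
    unfold IsSpanning at h
    push Not at h
    obtain ⟨T, hT⟩ := h
    have h1 := (mem_polymatroidOf_iff.1 ha).1 T
    rw [hsum] at hT
    refine ⟨T, ?_, ?_, ?_⟩ <;> split_ifs at hT <;> omega
  have hT : ∃ T : Finset (Fin n), Finset.univ.filter (fun j => b j < a j) ⊆ T ∧ i ∉ T ∧
      ∑ l ∈ T, a l = corank f T := by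
    generalize Finset.univ.filter (fun j => b j < a j) = S at hcover
    induction S using Finset.induction_on with
    | empty => exact ⟨∅, by simp, by simp, by simp⟩
    | insert j S _ ih =>
      obtain ⟨T, hT, hiT, hT'⟩ := ih fun l hl => hcover l (Finset.mem_insert_of_mem hl)
      obtain ⟨U, hU, hiU, hU'⟩ := hcover j (Finset.mem_insert_self j S)
      exact ⟨U ∪ T, Finset.insert_subset (Finset.mem_union_left _ hU)
        (hT.trans Finset.subset_union_right), by simp [hiT, hiU],
        hf.tight_union (mem_polymatroidOf_iff.1 ha).1 hU' hT'⟩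
  obtain ⟨T, hT, hiT, hT'⟩ := hT
  have h1 := (mem_polymatroidOf_iff.1 hb).1 T
  have h2 : ∑ l ∈ Finset.univ \ T, a l < ∑ l ∈ Finset.univ \ T, b l := by
    refine Finset.sum_lt_sum (fun l hl => ?_) ⟨i, by simpa using hiT, hi⟩
    by_contra! hlt
    exact (Finset.mem_sdiff.1 hl).2 (hT (by simpa using hlt))
  have h3 := Finset.sum_sdiff (f := a) (Finset.subset_univ T)
  have h4 := Finset.sum_sdiff (f := b) (Finset.subset_univ T)
  have h5 := ha.2
  have h6 := hb.2
  linarith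

end Corank

/-! ### External activity and the unique decomposition of spanning vectors -/

section ExteriorActivity

variable {n : ℕ} {f : Finset (Fin n) → ℤ} {P : Set (Fin n → ℤ)}

theorem mem_externallyActive {a : Fin n → ℤ} {i : Fin n} :
    i ∈ externallyActive P a ↔ ∀ j : Fin n, j < i → a + Pi.single i 1 - Pi.single j 1 ∉ P := by
  simp [externallyActive]

theorem card_externallyActive_le (a : Fin n → ℤ) : (externallyActive P a).card ≤ n := by
  simpa using Finset.card_le_univ (externallyActive P a)

theorem card_externallyActive_pos (hn : 0 < n) (a : Fin n → ℤ) :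
    0 < (externallyActive P a).card :=
  Finset.card_pos.2 ⟨⟨0, hn⟩, mem_externallyActive.2 fun j hj =>
    absurd hj (by simp [Fin.lt_def])⟩

theorem exists_le_externallyActive (hfin : P.Finite) {c : Fin n → ℤ}
    (hc : ∃ a ∈ P, ∀ i, a i ≤ c i) :
    ∃ a ∈ P, (∀ i, a i ≤ c i) ∧ ∀ i, a i < c i → i ∈ externallyActive P a := by
  -- Weighting entries by their index makes any move `+ e_i - e_j` with `j < i` increase the sum, so
  -- at a maximum every index with room below `c` is active.
  obtain ⟨a, ⟨haP, hac⟩, hmax⟩ := Set.exists_max_image {a | a ∈ P ∧ ∀ i, a i ≤ c i}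
    (fun a => ∑ l : Fin n, ((l : ℕ) : ℤ) * a l) (hfin.subset fun a ha => ha.1) hc
  refine ⟨a, haP, hac, fun i hi => mem_externallyActive.2 fun j hj hmem => ?_⟩
  have h := hmax _ ⟨hmem, fun l => ?_⟩
  · have h1 : (((j : ℕ) : ℤ)) < ((i : ℕ) : ℤ) := by exact_mod_cast hj
    simp only [Pi.sub_apply, Pi.add_apply, mul_sub, mul_add, Finset.sum_sub_distrib,
      Finset.sum_add_distrib, Pi.single_apply, mul_ite, mul_one, mul_zero, Finset.sum_ite_eq',
      Finset.mem_univ, if_true] at h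
    linarith
  · have h1 := hac l
    simp only [Pi.sub_apply, Pi.add_apply, Pi.single_apply]
    split_ifs with h2 h3 h3
    · omega
    · subst h2; omega
    · omega
    · omega

/-- At the largest index `i` where the two differ, exchange from the smaller entry uses some `j <
i`, against the activity of `i`. -/
theorem IsPolymatroid.eq_of_externallyActive (h : IsPolymatroid P f) {a b c : Fin n → ℤ}
    (ha : a ∈ P) (hb : b ∈ P) (hac : ∀ i, a i ≤ c i) (hbc : ∀ i, b i ≤ c i)
    (ha' : ∀ i, a i < c i → i ∈ externallyActive P a)
    (hb' : ∀ i, b i < c i → i ∈ externallyActive P b) : a = b := by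
  have key : ∀ {a b : Fin n → ℤ}, a ∈ P → b ∈ P → (∀ i, b i ≤ c i) →
      (∀ i, a i < c i → i ∈ externallyActive P a) →
      ∀ i, (∀ j, i < j → a j = b j) → ¬ a i < b i := by
    intro a b ha hb hbc ha' i hij hi
    rw [h.eq_polymatroidOf] at ha hb
    obtain ⟨j, hj, hmem⟩ := h.rank.exchange ha hb hi
    have hji : j < i := by
      rcases lt_trichotomy j i with hlt | rfl | hlt
      · exact hlt
      · omega
      · have := hij j hlt
        omega
    rw [← h.eq_polymatroidOf] at hmem
    exact mem_externallyActive.1 (ha' i (hi.trans_le (hbc i))) j hji hmem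
  by_contra hne
  obtain ⟨l, hl⟩ := Function.ne_iff.1 hne
  obtain ⟨i, hi, hmax⟩ := Finset.exists_max_image
    (Finset.univ.filter fun i => a i ≠ b i) id ⟨l, by simpa using hl⟩
  have hij : ∀ j, i < j → a j = b j := fun j hj => by
    by_contra hj'
    exact absurd (hmax j (by simpa using hj')) (not_le.2 hj)
  rcases lt_or_gt_of_ne (Finset.mem_filter.1 hi).2 with h1 | h1
  · exact key ha hb hbc ha' i hij h1
  · exact key hb ha hac hb' i (fun j hj => (hij j hj).symm) h1

theorem IsPolymatroid.isSpanning_iff (h : IsPolymatroid P f) {c : Fin n → ℤ} :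
    IsSpanning f c ↔ ∃ a ∈ P, ∀ i, a i ≤ c i := by
  rw [h.eq_polymatroidOf]
  exact ⟨h.rank.exists_le_of_isSpanning, fun ⟨a, ha, hac⟩ => (mem_polymatroidOf_iff.1 ha).1.mono hac⟩

-- The bijection is `(a, m) ↦ a + m`, with `m` of sum `t` supported on the active indices of `a`.
open Classical in
theorem IsPolymatroid.card_isSpanning (h : IsPolymatroid P f)
    (hP : ∀ a ∈ P, ∀ i : Fin n, 0 ≤ a i) {d : ℕ} (hd : f Finset.univ = d) (t : ℕ) :
    ((Finset.piAntidiag (Finset.univ : Finset (Fin n)) (d + t)).filter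
      fun c => IsSpanning f fun i => (c i : ℤ)).card =
      ∑ a ∈ h.finite.toFinset, (externallyActive P a).card.multichoose t := by
  have hsumP : ∀ a ∈ P, ∑ i, (a i).toNat = d := by
    intro a ha
    have h1 : ∑ i, a i = d := by
      have h2 := ha
      rw [h.eq_polymatroidOf] at h2
      rw [h2.2, hd]
    zify
    rw [← h1]
    exact Finset.sum_congr rfl fun i _ => Int.toNat_of_nonneg (hP a ha i)
  simp only [← Finset.card_piAntidiag_multichoose]
  rw [← Finset.card_sigma]
  symm
  refine Finset.card_bij (fun x _ i => (x.1 i).toNat + x.2 i) ?_ ?_ ?_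
  · rintro ⟨a, m⟩ hx
    simp only [Finset.mem_sigma, Set.Finite.mem_toFinset, Finset.mem_piAntidiag] at hx
    obtain ⟨ha, hm, hact⟩ := hx
    simp only [Finset.mem_filter, Finset.mem_piAntidiag, Finset.mem_univ, implies_true, and_true]
    refine ⟨?_, h.isSpanning_iff.2 ⟨a, ha, fun i => ?_⟩⟩
    · rw [Finset.sum_add_distrib, hsumP a ha, ← hm]
      congr 1
      symm
      refine Finset.sum_subset (Finset.subset_univ _) fun i _ hi => ?_
      by_contra h0
      exact hi (hact i h0)
    · have := hP a ha i
      push_cast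
      omega
  · rintro ⟨a, m⟩ hx ⟨b, m'⟩ hx' heq
    simp only [Finset.mem_sigma, Set.Finite.mem_toFinset, Finset.mem_piAntidiag] at hx hx'
    have heq' : ∀ i, (a i).toNat + m i = (b i).toNat + m' i := fun i => congrFun heq i
    have hab : a = b := by
      refine h.eq_of_externallyActive (c := fun i => ((a i).toNat + m i : ℕ)) hx.1 hx'.1
        ?_ ?_ ?_ ?_
      · intro i
        omega
      · intro i
        have := heq' i
        omega
      · intro i hi
        have := hP a hx.1 i
        exact hx.2.2 i (by omega)
      · intro i hi
        have := heq' i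
        have := hP b hx'.1 i
        exact hx'.2.2 i (by omega)
    subst hab
    have : m = m' := funext fun i => by have := heq' i; omega
    rw [this]
  · intro c hc
    simp only [Finset.mem_filter, Finset.mem_piAntidiag] at hc
    obtain ⟨⟨hsum, -⟩, hspan⟩ := hc
    obtain ⟨a, ha, hac, hact⟩ := exists_le_externallyActive h.finite (h.isSpanning_iff.1 hspan)
    have hle : ∀ i, (a i).toNat ≤ c i := fun i => by
      have := hac i
      omega
    have hm : ∀ i, c i - (a i).toNat ≠ 0 → i ∈ externallyActive P a := fun i hi => by
      refine hact i ?_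
      have := hP a ha i
      omega
    refine ⟨⟨a, fun i => c i - (a i).toNat⟩, ?_, ?_⟩
    · simp only [Finset.mem_sigma, Set.Finite.mem_toFinset, Finset.mem_piAntidiag]
      refine ⟨ha, ?_, hm⟩
      have h0 : ∑ i ∈ externallyActive P a, (c i - (a i).toNat) = ∑ i, (c i - (a i).toNat) :=
        Finset.sum_subset (Finset.subset_univ _) fun i _ hi => by
          by_contra h0
          exact hi (hm i h0)
      have h1 : ∑ i, c i = ∑ i, (c i - (a i).toNat) + ∑ i, (a i).toNat := by
        rw [← Finset.sum_add_distrib]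
        exact Finset.sum_congr rfl fun i _ => (Nat.sub_add_cancel (hle i)).symm
      rw [hsum, hsumP a ha] at h1
      rw [h0]
      omega
    · funext i
      have := hle i
      simp only
      omega

theorem IsPolymatroid.coeff_exteriorPolynomial (h : IsPolymatroid P f) (i : ℕ) :
    (exteriorPolynomial P).coeff i =
      ∑ a ∈ h.finite.toFinset, if i = n - (externallyActive P a).card then 1 else 0 := by
  rw [exteriorPolynomial, finsum_mem_eq_finite_toFinset_sum _ h.finite, finsetSum_coeff]
  simp only [coeff_X_pow]

theorem IsPolymatroid.coeff_exteriorPolynomial_card (h : IsPolymatroid P f) (hn : 0 < n) :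
    (exteriorPolynomial P).coeff n = 0 := by
  rw [h.coeff_exteriorPolynomial]
  refine Finset.sum_eq_zero fun a _ => if_neg ?_
  have := card_externallyActive_pos (P := P) hn a
  omega

theorem IsPolymatroid.sum_coeff_mul_multichoose (h : IsPolymatroid P f) (t : ℕ) :
    ∑ i ∈ Finset.range (n + 1), (exteriorPolynomial P).coeff i * ((n - i).multichoose t : ℤ) =
      ∑ a ∈ h.finite.toFinset, ((externallyActive P a).card.multichoose t : ℤ) := by
  simp only [h.coeff_exteriorPolynomial, Finset.sum_mul]
  rw [Finset.sum_comm]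
  refine Finset.sum_congr rfl fun a _ => ?_
  have := card_externallyActive_le (P := P) a
  rw [Finset.sum_eq_single_of_mem (n - (externallyActive P a).card) (by simp)]
  · rw [if_pos rfl, one_mul, Nat.sub_sub_self this]
  · intro i _ hi
    rw [if_neg hi, zero_mul]

/-! ### Counting nonspanning vectors -/

open Classical in
/-- The number of nonnegative vectors of sum `s` that lie above no member of the polymatroid
with rank function `f`. -/
noncomputable def nonspanningCount (f : Finset (Fin n) → ℤ) (s : ℕ) : ℕ :=
  ((Finset.piAntidiag (Finset.univ : Finset (Fin n)) s).filter
    fun c => ¬ IsSpanning f fun i => (c i : ℤ)).card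

theorem IsPolymatroid.nonspanningCount_eq (h : IsPolymatroid P f)
    (hP : ∀ a ∈ P, ∀ i : Fin n, 0 ≤ a i) {d : ℕ} (hd : f Finset.univ = d) (hn : 0 < n)
    {t : ℕ} (ht : 0 < t) :
    (nonspanningCount f (d + t) : ℤ) = ∑ i ∈ Finset.range (n + 1),
      ((d.multichoose i : ℤ) - (exteriorPolynomial P).coeff i) * ((n - i).multichoose t : ℤ) := by
  classical
  simp only [sub_mul, Finset.sum_sub_distrib]
  rw [h.sum_coeff_mul_multichoose]
  have h1 := h.card_isSpanning hP hd t
  have h2 := Finset.card_filter_add_card_filter_not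
    (s := Finset.piAntidiag (Finset.univ : Finset (Fin n)) (d + t))
    (p := fun c => IsSpanning f fun i => (c i : ℤ))
  obtain ⟨m, rfl⟩ := Nat.exists_eq_succ_of_ne_zero hn.ne'
  obtain ⟨s, rfl⟩ := Nat.exists_eq_succ_of_ne_zero ht.ne'
  have h3 := Nat.multichoose_succ_add m d (s + 1)
  rw [Finset.card_piAntidiag_multichoose, Finset.card_univ, Fintype.card_fin, h1, h3] at h2
  -- The total count has no term of index `n`; here that term vanishes because `t > 0`.
  rw [Finset.sum_range_succ, Nat.sub_self, Nat.multichoose_zero_succ, nonspanningCount]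
  zify at h2
  push_cast
  simp only [mul_zero, add_zero]
  rw [← h2]
  ring

/-- If the corank of a set is positive, then the vectors vanishing on it are not spanning. -/
theorem multichoose_le_nonspanningCount {J : Finset (Fin n)} (hJ : 0 < corank f J) (s : ℕ) :
    (n - J.card).multichoose s ≤ nonspanningCount f s := by
  classical
  have hcard : (Finset.univ \ J).card = n - J.card := by
    rw [Finset.card_sdiff_of_subset (Finset.subset_univ J), Finset.card_univ, Fintype.card_fin]
  rw [← hcard, ← Finset.card_piAntidiag_multichoose]
  refine Finset.card_le_card fun c hc => ?_
  rw [Finset.mem_piAntidiag] at hc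
  have h0 : ∀ i ∈ J, c i = 0 := fun i hi => by
    by_contra h
    exact (Finset.mem_sdiff.1 (hc.2 i h)).2 hi
  rw [Finset.mem_filter, Finset.mem_piAntidiag]
  refine ⟨⟨?_, by simp⟩, fun hspan => ?_⟩
  · rw [← hc.1]
    symm
    refine Finset.sum_subset (Finset.subset_univ _) fun i _ hi => ?_
    by_contra h
    exact hi (hc.2 i h)
  · have := hspan J
    rw [Finset.sum_eq_zero fun i hi => by simp [h0 i hi]] at this
    omega

open Classical in
theorem card_piAntidiag_filter_eq_on_le (S : Finset (Fin n)) (b : Fin n → ℕ) {s : ℕ}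
    (hs : ∑ i ∈ S, b i < s) :
    ((Finset.piAntidiag (Finset.univ : Finset (Fin n)) s).filter
      fun c => ∀ i ∈ S, c i = b i).card ≤ (n - S.card).multichoose s := by
  have hcard : (Finset.univ \ S).card = n - S.card := by
    rw [Finset.card_sdiff_of_subset (Finset.subset_univ S), Finset.card_univ, Fintype.card_fin]
  refine le_trans ?_ (Nat.multichoose_le_of_le (n - S.card) (s := s - ∑ i ∈ S, b i)
    (by omega) (Nat.sub_le _ _))
  rw [← hcard, ← Finset.card_piAntidiag_multichoose]
  refine Finset.card_le_card_of_injOn (fun c i => if i ∈ S then 0 else c i) ?_ ?_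
  · intro c hc
    simp only [Finset.coe_filter, Set.mem_ofPred_eq, Finset.mem_piAntidiag] at hc
    simp only [Finset.mem_coe, Finset.mem_piAntidiag]
    refine ⟨?_, fun i hi => by simpa using fun h : i ∈ S => hi (if_pos h)⟩
    have h1 : ∑ i ∈ Finset.univ \ S, c i + ∑ i ∈ S, c i = ∑ i, c i :=
      Finset.sum_sdiff (Finset.subset_univ S)
    rw [Finset.sum_congr rfl fun i hi => hc.2 i hi, hc.1.1] at h1
    rw [Finset.sum_congr rfl fun i hi => if_neg (Finset.mem_sdiff.1 hi).2]
    exact Nat.eq_sub_of_add_eq h1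
  · intro c hc c' hc' heq
    simp only [Finset.coe_filter, Set.mem_ofPred_eq] at hc hc'
    funext i
    by_cases hi : i ∈ S
    · rw [hc.2 i hi, hc'.2 i hi]
    · simpa [hi] using congrFun heq i

/-- A violated set has more than `k` elements, and the entries on it lie below the largest corank.
`C` counts the choices of `k + 1` positions and their bounded values. -/
theorem nonspanningCount_le_of_corank_nonpos {k : ℕ}
    (hk : ∀ S : Finset (Fin n), S.card ≤ k → corank f S ≤ 0) :
    ∃ C B : ℕ, ∀ s, B < s → nonspanningCount f s ≤ C * (n - (k + 1)).multichoose s := by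
  classical
  obtain ⟨B, hB⟩ : ∃ B : ℕ, ∀ S, corank f S ≤ B := by
    refine ⟨(∑ S, |corank f S|).toNat, fun S => (le_abs_self _).trans
      (le_trans ?_ (Int.self_le_toNat _))⟩
    exact Finset.single_le_sum (f := fun S => |corank f S|) (fun _ _ => abs_nonneg _)
      (Finset.mem_univ S)
  refine ⟨((Finset.powersetCard (k + 1) (Finset.univ : Finset (Fin n))) ×ˢ
    (Fintype.piFinset fun _ : Fin n => Finset.range B)).card, n * B, fun s hs => ?_⟩
  have hsub : (Finset.piAntidiag (Finset.univ : Finset (Fin n)) s).filter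
      (fun c => ¬ IsSpanning f fun i => (c i : ℤ)) ⊆
      ((Finset.powersetCard (k + 1) (Finset.univ : Finset (Fin n))) ×ˢ
        (Fintype.piFinset fun _ : Fin n => Finset.range B)).biUnion fun x =>
        (Finset.piAntidiag (Finset.univ : Finset (Fin n)) s).filter
          fun c => ∀ i ∈ x.1, c i = x.2 i := by
    intro c hc
    rw [Finset.mem_filter] at hc
    obtain ⟨hcs, hc⟩ := hc
    unfold IsSpanning at hc
    push Not at hc
    obtain ⟨S, hS⟩ := hc
    have hS0 : (0 : ℤ) ≤ ∑ i ∈ S, (c i : ℤ) := Finset.sum_nonneg fun i _ => by positivity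
    have hSk : k + 1 ≤ S.card := by
      by_contra! h
      have := hk S (by omega)
      omega
    have hcB : ∀ i ∈ S, c i < B := fun i hi => by
      have h1 := Finset.single_le_sum (f := fun i => (c i : ℤ)) (fun _ _ => by positivity) hi
      have h2 := hB S
      omega
    obtain ⟨T, hTS, hT⟩ := Finset.exists_subset_card_eq hSk
    have hBpos : 0 < B := by
      have := hB S
      omega
    simp only [Finset.mem_biUnion, Finset.mem_product, Finset.mem_powersetCard, Finset.mem_filter,
      Fintype.mem_piFinset, Finset.mem_range, Prod.exists]
    -- The values off `T` are irrelevant; zero keeps them in the finite box.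
    refine ⟨T, fun i => if i ∈ T then c i else 0,
      ⟨⟨Finset.subset_univ T, hT⟩, fun i => ?_⟩, hcs, fun i hi => (if_pos hi).symm⟩
    beta_reduce
    split_ifs with hi
    · exact hcB i (hTS hi)
    · exact hBpos
  refine (Finset.card_le_card hsub).trans (Finset.card_biUnion_le_card_mul _ _ _ ?_)
  rintro ⟨T, b⟩ hx
  simp only [Finset.mem_product, Finset.mem_powersetCard, Fintype.mem_piFinset,
    Finset.mem_range] at hx
  have hb : ∑ i ∈ T, b i ≤ n * B :=
    (Finset.sum_le_sum_of_subset (Finset.subset_univ T)).trans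
      ((Finset.sum_le_card_nsmul _ _ B fun i _ => (hx.2 i).le).trans (by simp))
  rw [← hx.1.2]
  exact card_piAntidiag_filter_eq_on_le T b (hb.trans_lt hs)

/-! ### The equivalence by comparison of growth -/

open Asymptotics Filter

theorem IsPolymatroid.coeff_eq_multichoose_iff_of_lt (h : IsPolymatroid P f)
    (hP : ∀ a ∈ P, ∀ i : Fin n, 0 ≤ a i) {d : ℕ} (hd : f Finset.univ = d) {k : ℕ} (hk : k < n) :
    (∀ J : Finset (Fin n), J.card = k → corank f J = 0) ↔
      ∀ i ≤ k, (exteriorPolynomial P).coeff i = d.multichoose i := by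
  set δ : ℕ → ℝ := fun i => ((d.multichoose i : ℤ) - (exteriorPolynomial P).coeff i : ℤ) with hδ
  have hD : (fun t : ℕ => ∑ i ∈ Finset.range (n + 1), δ i * ((n - i).multichoose t : ℝ))
      =ᶠ[atTop] fun t => (nonspanningCount f (d + t) : ℝ) := by
    filter_upwards [eventually_gt_atTop 0] with t ht
    have := h.nonspanningCount_eq hP hd (by omega) ht
    simp only [hδ]
    exact_mod_cast this.symm
  constructor
  · intro hJ
    have hnonpos : ∀ S : Finset (Fin n), S.card ≤ k → corank f S ≤ 0 := fun S hS => by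
      obtain ⟨J, hSJ, hJk⟩ := Finset.exists_superset_card_eq hS (by simpa using hk.le)
      exact (h.corank_mono hP hSJ).trans_eq (hJ J hJk)
    obtain ⟨C, B, hCB⟩ := nonspanningCount_le_of_corank_nonpos hnonpos
    have hO : (fun t => (nonspanningCount f (d + t) : ℝ)) =O[atTop]
        fun t : ℕ => ((n - (k + 1)).multichoose t : ℝ) := by
      -- The power absorbs the shift from `d + t` to `t`.
      refine IsBigO.of_bound (C * (n - (k + 1)) ^ d : ℕ) ?_
      filter_upwards [eventually_gt_atTop B] with t ht
      simp only [Real.norm_natCast]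
      have h1 := hCB (d + t) (by omega)
      have h2 := Nat.multichoose_add_right_le (n - (k + 1)) t d
      rw [add_comm t d] at h2
      have h3 := h1.trans (Nat.mul_le_mul_left C h2)
      rw [← mul_assoc] at h3
      exact_mod_cast h3
    have hzero := coeff_eq_zero_of_isLittleO_multichoose hk δ
      (hD.trans_isLittleO (hO.trans_isLittleO (isLittleO_multichoose (by omega))))
    intro i hi
    have h0 := hzero i hi
    simp only [hδ, Int.cast_eq_zero] at h0
    omega
  · intro hcoeff J hJk
    by_contra hne
    have hpos : 0 < corank f J := by
      refine lt_of_le_of_ne ?_ (Ne.symm hne)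
      simpa using h.corank_mono hP (Finset.empty_subset J)
    have ho := isLittleO_sum_multichoose (n := n) (l := k + 1) (m := n - k) δ
      (fun i hi => by simp [hδ, hcoeff i (by omega)]) (by omega) (Finset.range (n + 1))
      (fun i hi => by simpa [Nat.lt_succ_iff] using hi)
    refine not_isLittleO_multichoose_self (m := n - k) (by omega)
      (IsBigO.trans_isLittleO (IsBigO.of_bound 1 ?_) (hD.symm.trans_isLittleO ho))
    filter_upwards [eventually_gt_atTop 0] with t ht
    simp only [Real.norm_natCast, one_mul]
    rw [← hJk]
    exact_mod_cast (Nat.multichoose_le_of_le _ ht (Nat.le_add_left t d)).trans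
      (multichoose_le_nonspanningCount hpos (d + t))

end ExteriorActivity

theorem lemma5p7 (n : ℕ) (P : Set (Fin n → ℤ)) (f : Finset (Fin n) → ℤ)
    (hPf : IsPolymatroid P f) (hP : ∀ a ∈ P, ∀ i : Fin n, 0 ≤ a i)
    (k : ℕ) (hk : k ≤ n) :
    (∀ J : Finset (Fin n), J.card = k → f (Finset.univ \ J) = f Finset.univ) ↔
      ∀ i : ℕ, i ≤ k →
        (exteriorPolynomial P).coeff i = Ring.choose (f Finset.univ + (i : ℤ) - 1) i := by
  have hmono0 : ∀ S, 0 ≤ corank f S := fun S => by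
    simpa using hPf.corank_mono hP (Finset.empty_subset S)
  obtain ⟨d, hd⟩ := Int.eq_ofNat_of_zero_le (hPf.rank.corank_univ ▸ hmono0 Finset.univ)
  have hchoose : ∀ i : ℕ, Ring.choose (f Finset.univ + (i : ℤ) - 1) i = d.multichoose i := by
    intro i
    rw [hd, ← Ring.multichoose_eq, Nat.multichoose_eq]
    rfl
  have hJ : ∀ J : Finset (Fin n), f (Finset.univ \ J) = f Finset.univ ↔ corank f J = 0 :=
    fun J => by rw [corank, sub_eq_zero, eq_comm]
  simp only [hchoose, hJ]
  -- Growth cannot detect `k = n`, as `0.multichoose t` is zero for `t > 0`. For `k = n > 0` both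
  -- conditions reduce to `d = 0`: index 0 is always active, so the top coefficient vanishes.
  rcases hk.lt_or_eq with hk | rfl
  · exact hPf.coeff_eq_multichoose_iff_of_lt hP hd hk
  rcases Nat.eq_zero_or_pos k with rfl | hpos
  · refine ⟨fun _ i hi => ?_, fun _ J hJ0 => by simp [Finset.card_eq_zero.1 hJ0]⟩
    obtain rfl := Nat.le_zero.1 hi
    have hP0 : hPf.finite.toFinset = {0} := by
      ext a
      obtain ⟨b, hb, -⟩ := hPf.rank.exists_sum_eq_corank ∅
      rw [← hPf.eq_polymatroidOf] at hb
      rw [Set.Finite.mem_toFinset, Finset.mem_singleton]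
      exact iff_of_true (Subsingleton.elim b a ▸ hb) (Subsingleton.elim a 0)
    rw [hPf.coeff_exteriorPolynomial, hP0]
    simp
  have htop := hPf.coeff_exteriorPolynomial_card hpos
  have hcorank := hPf.rank.corank_univ
  constructor
  · intro h1
    have hd0 : d = 0 := by
      have := h1 Finset.univ (by simp)
      omega
    intro i hi
    rcases hi.lt_or_eq with hi | rfl
    · refine (hPf.coeff_eq_multichoose_iff_of_lt hP hd hi).1 (fun J _ => ?_) i le_rfl
      have h2 := hPf.corank_mono hP (Finset.subset_univ J)
      have h3 := hmono0 J
      omega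
    · obtain ⟨m, rfl⟩ := Nat.exists_eq_succ_of_ne_zero hpos.ne'
      rw [htop, hd0]
      simp
  · intro h2 J _
    have h3 := h2 k le_rfl
    rw [htop] at h3
    have hd0 : d = 0 := by
      by_contra hne
      have := Nat.multichoose_pos (Nat.pos_of_ne_zero hne) k
      omega
    have h4 := hPf.corank_mono hP (Finset.subset_univ J)
    have h5 := hmono0 J
    omega
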